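/- Let $G$ be a Lie group modelled on a Hausdorff locally convex space (smoothness in the sense of Michal–Bastiani), with Lie algebra $\mathfrak g$, a locally convex Lie algebra. Let $\bar\rho\colon G\to \mathrm{PU}(\mathcal H)=\mathrm U(\mathcal H)/\mathbb T\mathbf 1$ be a smooth projective unitary representation on a complex Hilbert space $\mathcal H$ (inner product linear in the second argument); that is, $\bar\rho$ is a group homomorphism and the set of rays $[\psi]\in\mathbb P(\mathcal H)$ whose orbit map $g\mapsto\bar\rho(g)[\psi]$ is smooth is dense in $\mathbb P(\mathcal H)$. Let $$G^\sharp=\{(g,U)\in G\times \mathrm U(\mathcal H) : \bar\rho(g)=\overline U\}$$ be the associated central extension of $G$ by $\mathbb T$, with the Lie group structure for which, $[\psi]$ being a smooth ray, the map $(g,z)\mapsto (g,z\rho_\psi(g))$ is a diffeomorphism of $\{g : \bar\rho(g)[\psi]\not\perp[\psi]\}\times\mathbb T$ onto an open subset; here $\rho_\psi(g)$ is the lift of $\bar\rho(g)$ with $\langle\psi,\rho_\psi(g)\psi\rangle>0$. Identify the Lie algebra of $\mathbb T$ with $\mathbb R$ by $t\mapsto e^{it}$. A class $[\omega]$ in the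 continuous Lie algebra cohomology $H^2(\mathfrak g,\mathbb R)$ is said to correspond to $\bar\rho$ if it is the class of the central Lie algebra extension $0\to\mathbb R\to\mathfrak g^\sharp\to\mathfrak g\to0$ derived from $\mathbb T\to G^\sharp\to G$. Let $[\omega]\in H^2(\mathfrak g,\mathbb R)$ correspond to $\bar\rho$. Then there exist a representative $\omega_\psi\in[\omega]$ (a continuous $2$-cocycle) and a continuous positive semidefinite sesquilinear form $H_\psi\colon\mathfrak g_{\mathbb C}\times\mathfrak g_{\mathbb C}\to\mathbb C$ (antilinear in the first argument) such that $$\omega_\psi(\xi,\eta)=-2\,\mathrm{Im}\,H_\psi(\xi,\eta)\quad\text{for all }\xi,\eta\in\mathfrak g,$$ $$\mathrm{Ker}(H_\psi)\subseteq \mathrm{Ker}(\omega_\psi)_{\mathbb C},$$ where $\mathrm{Ker}(H_\psi)=\{\zeta\in\mathfrak g_{\mathbb C} : H_\psi(\zeta,\zeta')=0\ \forall\zeta'\in\mathfrak g_{\mathbb C}\}$ and $\mathrm{Ker}(\omega_\psi)_{\mathbb C}$ is the complexification of $\{\xi\in\mathfrak g : \omega_\psi(\xi,\eta)=0\ \forall\eta\in\mathfrak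 g\}$. In particular the Heisenberg uncertainty relations hold: $$\tfrac12|\omega_\psi(\xi,\eta)|\le\|\xi\|_{H_\psi}\|\eta\|_{H_\psi}\quad\text{for all }\xi,\eta\in\mathfrak g,\qquad \|\xi\|_{H_\psi}=\sqrt{H_\psi(\xi,\xi)}.$$ -/

import Mathlib

open Set Filter Topology
open scoped LinearAlgebra.Projectivization

noncomputable section

/-! ### Smooth maps between locally convex spaces -/

section Calculus

variable {E F : Type*} [AddCommGroup E] [Module ℝ E]
  [AddCommGroup F] [Module ℝ F] [TopologicalSpace F]

/-- `v` is the derivative of `f` at `x` in the direction `h`: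
the limit of `t⁻¹ (f (x + t h) - f x)` as `t → 0` exists and equals `v`. -/
def HasDirDeriv (f : E → F) (x h : E) (v : F) : Prop :=
  Tendsto (fun t : ℝ => t⁻¹ • (f (x + t • h) - f x)) (𝓝[≠] 0) (𝓝 v)

/-- The derivative `∂_h f (x)` of `f` at `x` in the direction `h` (an arbitrary value if the
limit does not exist). -/
def dirDeriv (f : E → F) (x h : E) : F :=
  haveI : Nonempty F := ⟨0⟩
  limUnder (𝓝[≠] 0) (fun t : ℝ => t⁻¹ • (f (x + t • h) - f x))

/-- `f` is smooth (`C^∞` in the sense of Michal and Bastiani) on the open set `U`: all iterated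
directional derivatives `D j x (h₁, …, h_j) = (∂_{h_j} ⋯ ∂_{h₁} f)(x)` exist for `x ∈ U`, and all the
maps `D j : U × E^j → F` (in particular `D 0 = f`) are continuous. -/
def BSmoothOn [TopologicalSpace E] (f : E → F) (U : Set E) : Prop :=
  ∃ D : (j : ℕ) → E → (Fin j → E) → F,
    (∀ x ∈ U, ∀ h : Fin 0 → E, D 0 x h = f x) ∧
    (∀ j : ℕ, ∀ x ∈ U, ∀ (h : Fin j → E) (k : E),
      HasDirDeriv (fun y => D j y h) x k (D (j + 1) x (Fin.snoc h k))) ∧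
    ∀ j : ℕ, ContinuousOn (fun p : E × (Fin j → E) => D j p.1 p.2) (U ×ˢ univ)

end Calculus

/-! ### Locally convex Lie algebras and Lie groups -/

/-- A locally convex Lie algebra: a Hausdorff locally convex real topological vector space with
a continuous Lie bracket. -/
class IsLocallyConvexLieAlgebra (𝔤 : Type*) [LieRing 𝔤] [LieAlgebra ℝ 𝔤] [TopologicalSpace 𝔤] :
    Prop extends IsTopologicalAddGroup 𝔤, ContinuousSMul ℝ 𝔤, LocallyConvexSpace ℝ 𝔤,
      T2Space 𝔤 where
  continuous_lie : Continuous fun p : 𝔤 × 𝔤 => ⁅p.1, p.2⁆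

/-- A locally convex Lie group modelled on `E`: the transition maps of the atlas are smooth, and
multiplication and inversion are continuous and, in all charts of the atlas, smooth. -/
class IsLocallyConvexLieGroup (E G : Type*) [AddCommGroup E] [Module ℝ E] [TopologicalSpace E]
    [Group G] [TopologicalSpace G] [ChartedSpace E G] : Prop extends IsTopologicalGroup G where
  smooth_transition : ∀ e ∈ atlas E G, ∀ e' ∈ atlas E G,
    BSmoothOn (fun x => e' (e.symm x)) {x | x ∈ e.target ∧ e.symm x ∈ e'.source}
  smooth_mul : ∀ e₁ ∈ atlas E G, ∀ e₂ ∈ atlas E G, ∀ e₃ ∈ atlas E G,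
    BSmoothOn (fun p : E × E => e₃ (e₁.symm p.1 * e₂.symm p.2))
      {p | p.1 ∈ e₁.target ∧ p.2 ∈ e₂.target ∧ e₁.symm p.1 * e₂.symm p.2 ∈ e₃.source}
  smooth_inv : ∀ e ∈ atlas E G, ∀ e' ∈ atlas E G,
    BSmoothOn (fun x => e' (e.symm x)⁻¹) {x | x ∈ e.target ∧ (e.symm x)⁻¹ ∈ e'.source}

/-- Smoothness, on an open subset `O` of a manifold `M` modelled on `E`, of a map with values in a
locally convex space: smoothness in all charts of the atlas. -/
def MSmoothOn (E : Type*) {M F : Type*} [AddCommGroup E] [Module ℝ E] [TopologicalSpace E]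
    [TopologicalSpace M] [ChartedSpace E M] [AddCommGroup F] [Module ℝ F] [TopologicalSpace F]
    (f : M → F) (O : Set M) : Prop :=
  ∀ e ∈ atlas E M, BSmoothOn (fun x => f (e.symm x)) {x | x ∈ e.target ∧ e.symm x ∈ O}

/-- Let `m` be the multiplication of a Lie group expressed in a chart around the identity, and
let `e` be the image of the identity in the chart. The left invariant vector field with value
`w` at the identity is `X_w (x) = ∂_w (m x ·) (e)`, and the bracket of the Lie algebra is
`[v, w] = [X_v, X_w] (e) = ∂_v X_w (e) - ∂_w X_v (e)`. -/
def chartBracket {E : Type*} [AddCommGroup E] [Module ℝ E] [TopologicalSpace E]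
    (e : E) (m : E → E → E) (v w : E) : E :=
  dirDeriv (fun x => dirDeriv (m x) e w) e v - dirDeriv (fun x => dirDeriv (m x) e v) e w

/-- `𝔤` is the Lie algebra of the Lie group `G` modelled on `𝔤`, where the tangent space of `G` at
the identity is identified with `𝔤` by the preferred chart at the identity: the bracket of `𝔤` is
the bracket of left invariant vector fields. -/
def IsLieAlgebraOf (𝔤 G : Type*) [LieRing 𝔤] [LieAlgebra ℝ 𝔤] [TopologicalSpace 𝔤]
    [Group G] [TopologicalSpace G] [ChartedSpace 𝔤 G] : Prop :=
  ∀ ξ η : 𝔤, ⁅ξ, η⁆ = chartBracket (chartAt 𝔤 (1 : G) 1)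
    (fun x y => chartAt 𝔤 (1 : G) ((chartAt 𝔤 (1 : G)).symm x * (chartAt 𝔤 (1 : G)).symm y)) ξ η

/-! ### Continuous Lie algebra cohomology in degree two -/

section Cohomology

variable (𝔤 : Type*) [LieRing 𝔤] [LieAlgebra ℝ 𝔤] [TopologicalSpace 𝔤]

/-- The continuous 2-cocycles: continuous alternating bilinear forms `ω` on `𝔤` with `δω = 0`. -/
def ContTwoCocycles : Submodule ℝ (𝔤 → 𝔤 → ℝ) where
  carrier := {ω | (∀ x, IsLinearMap ℝ (ω x)) ∧ (∀ y, IsLinearMap ℝ (fun x => ω x y)) ∧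
    (Continuous fun p : 𝔤 × 𝔤 => ω p.1 p.2) ∧ (∀ x, ω x x = 0) ∧
    ∀ x y z, ω ⁅x, y⁆ z + ω ⁅y, z⁆ x + ω ⁅z, x⁆ y = 0}
  zero_mem' := ⟨fun x => (0 : 𝔤 →ₗ[ℝ] ℝ).isLinear, fun y => (0 : 𝔤 →ₗ[ℝ] ℝ).isLinear,
    continuous_const, by simp, by simp⟩
  add_mem' := by
    rintro a b ⟨ha1, ha2, ha3, ha4, ha5⟩ ⟨hb1, hb2, hb3, hb4, hb5⟩
    refine ⟨fun x => ((ha1 x).mk' _ + (hb1 x).mk' _).isLinear,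
      fun y => ((ha2 y).mk' _ + (hb2 y).mk' _).isLinear, ha3.add hb3,
      fun x => by simp [ha4, hb4], fun x y z => ?_⟩
    have h1 := ha5 x y z
    have h2 := hb5 x y z
    simp only [Pi.add_apply]
    linarith
  smul_mem' := by
    rintro c a ⟨ha1, ha2, ha3, ha4, ha5⟩
    refine ⟨fun x => (c • (ha1 x).mk' _).isLinear, fun y => (c • (ha2 y).mk' _).isLinear,
      ha3.const_smul c, fun x => by simp [ha4], fun x y z => ?_⟩
    have h1 := ha5 x y z
    simp only [Pi.smul_apply, smul_eq_mul]
    rw [← mul_add, ← mul_add, h1, mul_zero]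

/-- The 2-cocycles of the form `δβ`, `δβ (x, y) = -β ([x, y])`, with `β : 𝔤 → ℝ` continuous and
linear. -/
def ContTwoCoboundaries : Submodule ℝ (ContTwoCocycles 𝔤) where
  carrier := {ω | ∃ β : 𝔤 →L[ℝ] ℝ, ∀ x y : 𝔤, ω.1 x y = -β ⁅x, y⁆}
  zero_mem' := ⟨0, by intro x y; simp⟩
  add_mem' := by
    rintro a b ⟨β, hβ⟩ ⟨γ, hγ⟩
    refine ⟨β + γ, fun x y => ?_⟩
    simp [hβ, hγ]
    ring
  smul_mem' := by
    rintro c a ⟨β, hβ⟩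
    refine ⟨c • β, fun x y => ?_⟩
    simp [hβ]

/-- The second continuous Lie algebra cohomology `H²(𝔤, ℝ)`. -/
abbrev ContH2 : Type _ := ContTwoCocycles 𝔤 ⧸ ContTwoCoboundaries 𝔤

variable {𝔤}

/-- The class `[ω] ∈ H²(𝔤, ℝ)` of a 2-cocycle `ω`. -/
def cohomClass (ω : ContTwoCocycles 𝔤) : ContH2 𝔤 := (ContTwoCoboundaries 𝔤).mkQ ω

/-- The kernel `{ξ | ω (ξ, η) = 0 for all η}` of an alternating form. -/
def formKer (ω : 𝔤 → 𝔤 → ℝ) : Set 𝔤 := {ξ | ∀ η : 𝔤, ω ξ η = 0}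

/-- Let `br` be the bracket of a central extension `0 → ℝ → 𝔤 × ℝ → 𝔤 → 0` of locally convex Lie
algebras with the obvious maps. The class of the extension is represented by `ω` if and only if
there is a continuous linear map `σ` from the extension to `ℝ`, the identity on `ℝ`, such
that `ω (ξ, η)` is the value of `σ` on the bracket of any two lifts of `ξ` and `η`. -/
def RepresentsExtension (br : 𝔤 × ℝ → 𝔤 × ℝ → 𝔤 × ℝ) (ω : ContTwoCocycles 𝔤) : Prop :=
  ∃ σ : 𝔤 × ℝ →L[ℝ] ℝ, (∀ t : ℝ, σ (0, t) = t) ∧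
    ∀ p q : 𝔤 × ℝ, ω.1 p.1 q.1 = σ (br p q)

end Cohomology

/-! ### The complexification of a locally convex space -/

/-- The complexification `V_ℂ = V ⊕ iV`; the pair `(ξ, η)` stands for `ξ + iη`. -/
def Complexified (V : Type*) : Type _ := V × V

namespace Complexified

variable {V : Type*}

instance [AddCommGroup V] : AddCommGroup (Complexified V) := inferInstanceAs (AddCommGroup (V × V))

instance [TopologicalSpace V] : TopologicalSpace (Complexified V) :=
  inferInstanceAs (TopologicalSpace (V × V))

/-- The real part `ξ` of `ξ + iη`. -/
def re (ζ : Complexified V) : V := Prod.fst ζ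

/-- The imaginary part `η` of `ξ + iη`. -/
def im (ζ : Complexified V) : V := Prod.snd ζ

/-- The element `ξ + iη`. -/
def mk (ξ η : V) : Complexified V := (ξ, η)

@[simp] theorem re_mk (ξ η : V) : (mk ξ η).re = ξ := rfl
@[simp] theorem im_mk (ξ η : V) : (mk ξ η).im = η := rfl

@[ext] theorem ext {a b : Complexified V} (h₁ : a.re = b.re) (h₂ : a.im = b.im) : a = b :=
  Prod.ext h₁ h₂

/-- The inclusion of `V` into its complexification. -/
def ofReal [AddCommGroup V] (ξ : V) : Complexified V := mk ξ 0

/-- The complexification `S_ℂ = S + iS` of a subspace `S` of `V`. -/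
def complexify (S : Set V) : Set (Complexified V) := {ζ | ζ.re ∈ S ∧ ζ.im ∈ S}

section Module

variable [AddCommGroup V]

@[simp] theorem re_add (a b : Complexified V) : (a + b).re = a.re + b.re := rfl
@[simp] theorem im_add (a b : Complexified V) : (a + b).im = a.im + b.im := rfl
@[simp] theorem re_zero : (0 : Complexified V).re = 0 := rfl
@[simp] theorem im_zero : (0 : Complexified V).im = 0 := rfl

variable [Module ℝ V]

instance : SMul ℂ (Complexified V) :=
  ⟨fun z ζ => mk (z.re • ζ.re - z.im • ζ.im) (z.re • ζ.im + z.im • ζ.re)⟩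

@[simp] theorem re_smul (z : ℂ) (a : Complexified V) :
    (z • a).re = z.re • a.re - z.im • a.im := rfl
@[simp] theorem im_smul (z : ℂ) (a : Complexified V) :
    (z • a).im = z.re • a.im + z.im • a.re := rfl

instance : Module ℂ (Complexified V) where
  one_smul a := by ext <;> simp
  mul_smul z w a := by ext <;> simp <;> module
  smul_zero z := by ext <;> simp
  smul_add z a b := by ext <;> simp <;> module
  add_smul z w a := by ext <;> simp <;> module
  zero_smul a := by ext <;> simp

end Module

end Complexified

/-- The sesquilinear form `h` on a complex topological vector space is continuous and positive
semidefinite. -/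
structure IsContPosSemidef {W : Type*} [AddCommGroup W] [Module ℂ W] [TopologicalSpace W]
    (h : W →ₗ⋆[ℂ] W →ₗ[ℂ] ℂ) : Prop where
  continuous : Continuous fun p : W × W => h p.1 p.2
  re_nonneg : ∀ ζ, 0 ≤ (h ζ ζ).re
  im_eq_zero : ∀ ζ, (h ζ ζ).im = 0

/-- The kernel `{ζ | h (ζ, ζ') = 0 for all ζ'}` of a sesquilinear form. -/
def sesqKer {W : Type*} [AddCommGroup W] [Module ℂ W] (h : W →ₗ⋆[ℂ] W →ₗ[ℂ] ℂ) : Set W :=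
  {ζ | ∀ ζ', h ζ ζ' = 0}

/-! ### Projective unitary representations -/

section Projective

variable (H : Type*) [NormedAddCommGroup H] [InnerProductSpace ℂ H]

/-- The scalar operators `z · 1`, `z ∈ 𝕋`, in the unitary group `U(H) = (H ≃ₗᵢ[ℂ] H)`. -/
def scalarUnitary : Circle →* (H ≃ₗᵢ[ℂ] H) where
  toFun z :=
    { DistribMulAction.toLinearEquiv ℂ H z with
      norm_map' := fun v => Circle.norm_smul z v }
  map_one' := by ext v; exact one_smul _ v
  map_mul' z w := by ext v; exact mul_smul z w v

instance scalarUnitary_range_normal : (scalarUnitary H).range.Normal where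
  conj_mem := by
    rintro _ ⟨z, rfl⟩ U
    refine ⟨z, ?_⟩
    ext v
    have h : U ((z : ℂ) • U⁻¹ v) = (z : ℂ) • v := by
      rw [map_smul]
      exact congrArg _ (U.apply_symm_apply v)
    exact h.symm

/-- The projective unitary group `PU(H) = U(H) / 𝕋1`. -/
abbrev ProjUnitary : Type _ := (H ≃ₗᵢ[ℂ] H) ⧸ (scalarUnitary H).range

variable {H}

/-- The action `[φ] ↦ [Uφ]` of a unitary operator on the projective space. -/
def unitaryOnRays (U : H ≃ₗᵢ[ℂ] H) : ℙ ℂ H → ℙ ℂ H :=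
  Projectivization.map U.toLinearEquiv.toLinearMap U.injective

/-- The action of `PU(H)` on the projective space `ℙ(H)`. -/
def projUnitaryOnRays (P : ProjUnitary H) : ℙ ℂ H → ℙ ℂ H :=
  Quotient.liftOn' P unitaryOnRays (by
    intro U V h
    rw [QuotientGroup.leftRel_apply] at h
    obtain ⟨z, hz⟩ := h
    have hV : V = U * scalarUnitary H z := by rw [hz]; simp
    subst hV
    funext r
    induction r using Projectivization.ind with
    | h v hv =>
      refine (Projectivization.mk_eq_mk_iff' ℂ _ _ _ _).2 ⟨(z : ℂ)⁻¹, ?_⟩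
      have h : (z : ℂ)⁻¹ • U ((z : ℂ) • v) = U v := by
        rw [map_smul, smul_smul, inv_mul_cancel₀ z.coe_ne_zero, one_smul]
      exact h)

/-- The topology of the projective space `ℙ(H)`: the quotient topology. -/
instance projectiveTopology : TopologicalSpace (ℙ ℂ H) :=
  TopologicalSpace.coinduced (fun v : {v : H // v ≠ 0} => Projectivization.mk ℂ v.1 v.2)
    inferInstance

/-- The domain `{[χ] | ⟨φ, χ⟩ ≠ 0}` of the chart of `ℙ(H)` around `[φ]`. -/
def projChartDomain (φ : H) : Set (ℙ ℂ H) := {r | inner ℂ φ r.rep ≠ 0}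

/-- The chart `[φ + u] ↦ u`, `u ⟂ φ`, of the Hilbert manifold `ℙ(H)` around `[φ]`, for a unit
vector `φ`; in other words `[χ] ↦ ⟨φ, χ⟩⁻¹ χ - φ`. -/
def projChart (φ : H) (r : ℙ ℂ H) : H := (inner ℂ φ r.rep)⁻¹ • r.rep - φ

variable {G : Type*} [Group G]

/-- The orbit map `g ↦ ρ(g)[ψ]` of a ray under a projective unitary representation. -/
def rayOrbit (ρ : G →* ProjUnitary H) (r : ℙ ℂ H) (g : G) : ℙ ℂ H := projUnitaryOnRays (ρ g) r

/-- A ray is smooth if its orbit map is a smooth map into the Hilbert manifold `ℙ(H)`. -/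
def IsSmoothRay (𝔤 : Type*) [AddCommGroup 𝔤] [Module ℝ 𝔤] [TopologicalSpace 𝔤]
    [TopologicalSpace G] [ChartedSpace 𝔤 G] (ρ : G →* ProjUnitary H) (r : ℙ ℂ H) : Prop :=
  Continuous (rayOrbit ρ r) ∧
    ∀ φ : H, ‖φ‖ = 1 →
      MSmoothOn 𝔤 (fun g => projChart φ (rayOrbit ρ r g)) (rayOrbit ρ r ⁻¹' projChartDomain φ)

/-- A projective unitary representation is smooth if the set of smooth rays is dense. -/
def IsSmoothProjRep (𝔤 : Type*) [AddCommGroup 𝔤] [Module ℝ 𝔤] [TopologicalSpace 𝔤]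
    [TopologicalSpace G] [ChartedSpace 𝔤 G] (ρ : G →* ProjUnitary H) : Prop :=
  Dense {r : ℙ ℂ H | IsSmoothRay 𝔤 ρ r}

/-! ### The central extension of a projective unitary representation -/

/-- The central `𝕋`-extension `G♯ = {(g, U) ∈ G × U(H) | ρ(g) = [U]}` of `G`. -/
def sharpGroup (ρ : G →* ProjUnitary H) : Subgroup (G × (H ≃ₗᵢ[ℂ] H)) :=
  MonoidHom.eqLocus (ρ.comp (MonoidHom.fst G (H ≃ₗᵢ[ℂ] H)))
    ((QuotientGroup.mk' (scalarUnitary H).range).comp (MonoidHom.snd G (H ≃ₗᵢ[ℂ] H)))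

/-- The central embedding `z ↦ (1, z1)` of `𝕋` into `G♯`. -/
def circleToSharp (ρ : G →* ProjUnitary H) (z : Circle) : sharpGroup ρ :=
  ⟨(1, scalarUnitary H z), by
    change ρ 1 = QuotientGroup.mk' (scalarUnitary H).range (scalarUnitary H z)
    rw [map_one, eq_comm]
    exact (QuotientGroup.eq_one_iff _).2 ⟨z, rfl⟩⟩

/-- The element `(g, ρ_ψ(g))` of `G♯`, where `ρ_ψ(g)` is the unique lift of `ρ(g)` with
`⟨ψ, ρ_ψ(g)ψ⟩ > 0` (an arbitrary element of `G♯` if `ρ(g)[ψ]` is orthogonal to `[ψ]`). -/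
def sharpLift (ρ : G →* ProjUnitary H) (ψ : H) (g : G) : sharpGroup ρ :=
  Classical.epsilon fun γ : sharpGroup ρ =>
    γ.1.1 = g ∧ 0 < (inner ℂ ψ (γ.1.2 ψ)).re ∧ (inner ℂ ψ (γ.1.2 ψ)).im = 0

section Chart

variable {𝔤 : Type*} [TopologicalSpace 𝔤] [TopologicalSpace G] [ChartedSpace 𝔤 G]

/-- The Lie group structure of `G♯` is the one for which `(g, z) ↦ (g, ρ_ψ(g) z)` is a
diffeomorphism from `{g | ρ(g)[ψ] not orthogonal to [ψ]} × 𝕋` onto an open subset. Combined with the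
preferred chart of `G` at the identity and with `θ ↦ exp (iθ)`, this gives a chart of `G♯` around
the identity with values in `𝔤 × ℝ`. The present map is the inverse of this chart,
`(x, θ) ↦ (g, ρ_ψ(g) exp (iθ))` with `g` the point of `G` with coordinate `x`. -/
def sharpChartInv (ρ : G →* ProjUnitary H) (ψ : H) (p : 𝔤 × ℝ) : sharpGroup ρ :=
  sharpLift ρ ψ ((chartAt 𝔤 (1 : G)).symm p.1) * circleToSharp ρ (Circle.exp p.2)

/-- The chart of `G♯` around the identity which is inverse to `sharpChartInv`: the
element `(g, ρ_ψ(g) exp (iθ))` has `⟨ψ, ρ_ψ(g) exp (iθ) ψ⟩ = exp (iθ) |⟨ψ, ρ_ψ(g) ψ⟩|`, so that `θ`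
is the argument of this number. -/
def sharpChart (ρ : G →* ProjUnitary H) (ψ : H) (γ : sharpGroup ρ) : 𝔤 × ℝ :=
  (chartAt 𝔤 (1 : G) γ.1.1, (inner ℂ ψ (γ.1.2 ψ)).arg)

variable [AddCommGroup 𝔤] [Module ℝ 𝔤]

/-- The bracket of the Lie algebra `𝔤♯` of `G♯`, whose tangent space at the identity is identified
with `𝔤 × ℝ` by the chart `sharpChart`. The derivatives at the identity of `𝕋 → G♯` and `G♯ → G` are
then the inclusion `t ↦ (0, t)` and the projection `(ξ, t) ↦ ξ`. -/
def sharpBracket (ρ : G →* ProjUnitary H) (ψ : H) : 𝔤 × ℝ → 𝔤 × ℝ → 𝔤 × ℝ :=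
  chartBracket (sharpChart ρ ψ 1)
    (fun p q => sharpChart ρ ψ (sharpChartInv ρ ψ p * sharpChartInv ρ ψ q))

end Chart

/-- The class `c ∈ H²(𝔤, ℝ)` corresponds to the projective unitary representation `ρ`: it is the
class of the central extension `0 → ℝ → 𝔤♯ → 𝔤 → 0` derived from `𝕋 → G♯ → G`, where the Lie group
structure on `G♯` is given by a smooth ray `[ψ]`. -/
def CorrespondsTo {𝔤 : Type*} [LieRing 𝔤] [LieAlgebra ℝ 𝔤] [TopologicalSpace 𝔤]
    [TopologicalSpace G] [ChartedSpace 𝔤 G] (ρ : G →* ProjUnitary H) (c : ContH2 𝔤) : Prop :=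
  ∃ (ψ : H) (hψ : ψ ≠ 0), IsSmoothRay 𝔤 ρ (Projectivization.mk ℂ ψ hψ) ∧
    ∃ ω : ContTwoCocycles 𝔤, cohomClass ω = c ∧ RepresentsExtension (sharpBracket ρ ψ) ω

end Projective

end

noncomputable section

/-! ### Directional derivatives -/

section Calculus

variable {E F : Type*} [AddCommGroup E] [Module ℝ E]
  [AddCommGroup F] [Module ℝ F] [TopologicalSpace F]

/-! Normalise `ψ` to a unit vector `φ`, and let `u(g) ⟂ φ` be the affine coordinate of the ray
`ρ(g)[φ]`, so that the positive lift satisfies `ρ_φ(g)φ = c(φ + u(g))` with `c > 0`. Moving `ρ_φ(g)`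
to the other side of the inner product shows that `⟨φ, ρ_φ(g)ρ_φ(k)φ⟩` is a positive multiple of `1
+ ⟨u(g⁻¹), u(k)⟩`. The phase of a product in `G♯` is therefore `arg (1 + ⟨u(g⁻¹), u(k)⟩)`
(`arg_inner_sharpLift_mul`).

Let `A : 𝔤 → H` be the derivative of `u` at the identity. Since `u` vanishes there and inversion has
derivative `-1` (`HasContDirDerivNear.deriv_inverse`), the mixed second derivative of the phase is
`-Im ⟨Aξ, Aη⟩`. Antisymmetrising gives `[(ξ,0),(η,0)] = ([ξ,η], -2 Im ⟨Aξ, Aη⟩)` in `𝔤♯`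
(`exists_sharpBracket_eq`). Changing the splitting alters the cocycle by a coboundary, so `-2 Im
⟨Aξ, Aη⟩` represents the class.

The complex extension of `⟨Aξ, Aη⟩` is positive, but its kernel contains every `ξ + iη` with `Aξ =
-iAη`, where `Aξ` need not vanish. `orbitForm` adds a conjugate term, which forces `Aξ = Aη = 0` on
the kernel. The uncertainty relation is Cauchy–Schwarz in `H`. -/

theorem HasDirDeriv.dirDeriv_eq [T2Space F] {f : E → F} {x h : E} {v : F}
    (hf : HasDirDeriv f x h v) : dirDeriv f x h = v :=
  haveI : Nonempty F := ⟨0⟩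
  hf.limUnder_eq

theorem HasDirDeriv.unique [T2Space F] {f : E → F} {x h : E} {v w : F}
    (hv : HasDirDeriv f x h v) (hw : HasDirDeriv f x h w) : v = w :=
  tendsto_nhds_unique hv hw

theorem tendsto_add_smul_nhds [TopologicalSpace E] [IsTopologicalAddGroup E] [ContinuousSMul ℝ E]
    (x h : E) : Tendsto (fun t : ℝ => x + t • h) (𝓝 0) (𝓝 x) := by
  have : Continuous fun t : ℝ => x + t • h := by fun_prop
  simpa using this.tendsto 0

theorem HasDirDeriv.congr_of_eventuallyEq [TopologicalSpace E] [IsTopologicalAddGroup E]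
    [ContinuousSMul ℝ E] {f g : E → F} {x h : E} {v : F}
    (hf : HasDirDeriv f x h v) (hfg : g =ᶠ[𝓝 x] f) : HasDirDeriv g x h v := by
  refine Tendsto.congr' ?_ hf
  filter_upwards [((tendsto_add_smul_nhds x h).eventually hfg).filter_mono nhdsWithin_le_nhds]
    with t ht
  rw [ht, hfg.self_of_nhds]

theorem HasDirDeriv.prodMk {F' : Type*} [AddCommGroup F'] [Module ℝ F'] [TopologicalSpace F']
    {f : E → F} {g : E → F'} {x h : E} {v : F} {w : F'}
    (hf : HasDirDeriv f x h v) (hg : HasDirDeriv g x h w) :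
    HasDirDeriv (fun y => (f y, g y)) x h (v, w) :=
  Tendsto.prodMk_nhds hf hg

theorem HasDirDeriv.clm_comp {F' : Type*} [AddCommGroup F'] [Module ℝ F'] [TopologicalSpace F']
    (l : F →L[ℝ] F') {f : E → F} {x h : E} {v : F} (hf : HasDirDeriv f x h v) :
    HasDirDeriv (fun y => l (f y)) x h (l v) := by
  have := (l.continuous.tendsto v).comp hf
  refine this.congr fun t => ?_
  simp

theorem hasDirDeriv_id [ContinuousAdd F] [ContinuousSMul ℝ F] (x h : F) :
    HasDirDeriv (fun y => y) x h h := by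
  refine tendsto_const_nhds.congr' ?_
  filter_upwards [self_mem_nhdsWithin] with t ht
  rw [add_sub_cancel_left, smul_smul, inv_mul_cancel₀ ht, one_smul]

theorem HasDirDeriv.smul [ContinuousConstSMul ℝ F] {f : E → F} {x h : E} {v : F}
    (hf : HasDirDeriv f x h v) (c : ℝ) : HasDirDeriv f x (c • h) (c • v) := by
  rcases eq_or_ne c 0 with rfl | hc
  · simpa [HasDirDeriv] using tendsto_const_nhds
  · have hlim : Tendsto (fun t : ℝ => t * c) (𝓝[≠] 0) (𝓝[≠] 0) := by
      refine tendsto_nhdsWithin_iff.2 ⟨?_, ?_⟩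
      · have : Continuous fun t : ℝ => t * c := by fun_prop
        simpa using (this.tendsto 0).mono_left nhdsWithin_le_nhds
      · filter_upwards [self_mem_nhdsWithin] with t ht
        exact mul_ne_zero ht hc
    refine ((hf.comp hlim).const_smul c).congr fun t => ?_
    simp only [Function.comp, smul_smul, mul_inv]
    rw [mul_comm t⁻¹, ← mul_assoc, mul_inv_cancel₀ hc, one_mul]

theorem HasDirDeriv.hasDerivAt {F : Type*} [NormedAddCommGroup F] [NormedSpace ℝ F]
    {f : E → F} {x h : E} {v : F} {t : ℝ} (hf : HasDirDeriv f (x + t • h) h v) :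
    HasDerivAt (fun s : ℝ => f (x + s • h)) v t := by
  rw [hasDerivAt_iff_tendsto_slope_zero]
  refine hf.congr fun s => ?_
  simp only [add_smul, add_assoc]

/-- `f'` is a continuous directional derivative of `f` near `x₀`. -/
structure HasContDirDerivNear [TopologicalSpace E] (f : E → F) (f' : E → E → F) (x₀ : E) :
    Prop where
  eventually_hasDirDeriv : ∀ᶠ x in 𝓝 x₀, ∀ h, HasDirDeriv f x h (f' x h)
  continuousAt : ∀ h, ContinuousAt (fun p : E × E => f' p.1 p.2) (x₀, h)

theorem HasContDirDerivNear.hasDirDeriv [TopologicalSpace E] {f : E → F} {f' : E → E → F} {x₀ : E}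
    (hf : HasContDirDerivNear f f' x₀) (h : E) : HasDirDeriv f x₀ h (f' x₀ h) :=
  hf.eventually_hasDirDeriv.self_of_nhds h

theorem HasContDirDerivNear.clm_comp [TopologicalSpace E] {F' : Type*} [AddCommGroup F']
    [Module ℝ F'] [TopologicalSpace F'] (l : F →L[ℝ] F') {f : E → F} {f' : E → E → F} {x₀ : E}
    (hf : HasContDirDerivNear f f' x₀) :
    HasContDirDerivNear (fun x => l (f x)) (fun x h => l (f' x h)) x₀ :=
  ⟨hf.1.mono fun _ hx h => (hx h).clm_comp l, fun h => l.continuous.continuousAt.comp (hf.2 h)⟩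

/-- All that the bracket computation needs from smoothness: a jointly continuous first derivative,
for the chain rule, and the existence of second derivatives. -/
theorem BSmoothOn.exists_deriv [TopologicalSpace E] [IsTopologicalAddGroup E] [ContinuousSMul ℝ E]
    {f : E → F} {U : Set E} (hf : BSmoothOn f U) (hU : IsOpen U) :
    ∃ (f' : E → E → F) (f'' : E → E → E → F), (∀ x ∈ U, HasContDirDerivNear f f' x) ∧
      ∀ x ∈ U, ∀ h k, HasDirDeriv (fun y => f' y h) x k (f'' x h k) := by
  obtain ⟨D, hD0, hD, hDc⟩ := hf
  refine ⟨fun x h => D 1 x (Fin.snoc (α := fun _ => E) Fin.elim0 h),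
    fun x h k => D 2 x (Fin.snoc (α := fun _ => E) (Fin.snoc (α := fun _ => E) Fin.elim0 h) k),
    fun x hx => ⟨?_, fun h => ?_⟩, fun x hx h k => hD 1 x hx _ k⟩
  · filter_upwards [hU.mem_nhds hx] with y hy h
    refine (hD 0 y hy Fin.elim0 h).congr_of_eventuallyEq ?_
    filter_upwards [hU.mem_nhds hy] with z hz
    exact (hD0 z hz _).symm
  · have h1 : ContinuousAt (fun p : E × (Fin 1 → E) => D 1 p.1 p.2) (x, fun _ => h) :=
      (hDc 1).continuousAt ((hU.prod isOpen_univ).mem_nhds ⟨hx, mem_univ _⟩)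
    have h2 : Continuous fun p : E × E => ((p.1, fun _ => p.2) : E × (Fin 1 → E)) := by fun_prop
    -- A tuple of length one is constant, so continuity in the tuple is continuity in the direction.
    have h3 : ∀ k : E, (Fin.snoc (α := fun _ => E) Fin.elim0 k : Fin 1 → E) = fun _ => k := by
      intro k
      funext i
      rw [Fin.eq_zero i]
      rfl
    simp only [h3]
    exact ContinuousAt.comp (f := fun p : E × E => ((p.1, fun _ => p.2) : E × (Fin 1 → E)))
      (x := (x, h)) h1 h2.continuousAt

/-! ### Strict differentiability and the chain rule for maps into normed spaces -/

section Chain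

variable [TopologicalSpace E] [IsTopologicalAddGroup E] [ContinuousSMul ℝ E]
  {W : Type*} [NormedAddCommGroup W] [NormedSpace ℝ W]

/-- Strict differentiability of a function with continuous directional derivatives. -/
theorem HasContDirDerivNear.tendsto_strict {f : E → W} {f' : E → E → W} {x₀ h : E}
    (hf : HasContDirDerivNear f f' x₀) {b c : ℝ → E}
    (hb : Tendsto b (𝓝[≠] 0) (𝓝 x₀)) (hc : Tendsto c (𝓝[≠] 0) (𝓝 h)) :
    Tendsto (fun t : ℝ => t⁻¹ • (f (b t + t • c t) - f (b t))) (𝓝[≠] 0) (𝓝 (f' x₀ h)) := by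
  rw [Metric.tendsto_nhds]
  intro ε hε
  have hN : ∀ᶠ p : E × E in 𝓝 (x₀, h),
      (∀ k, HasDirDeriv f p.1 k (f' p.1 k)) ∧ ‖f' p.1 p.2 - f' x₀ h‖ ≤ ε / 2 := by
    refine ((continuous_fst.tendsto (x₀, h)).eventually hf.eventually_hasDirDeriv).and ?_
    filter_upwards [(hf.continuousAt h).eventually (Metric.closedBall_mem_nhds _ (half_pos hε))]
      with p hp
    simpa [dist_eq_norm] using hp
  have hcont : Continuous fun q : ℝ × E × E => ((q.2.1 + q.1 • q.2.2, q.2.2) : E × E) := by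
    fun_prop
  have hlim : Tendsto (fun q : ℝ × E × E => ((q.2.1 + q.1 • q.2.2, q.2.2) : E × E))
      (𝓝 (0, x₀, h)) (𝓝 (x₀, h)) := by
    simpa using hcont.tendsto (0, x₀, h)
  have hev := hlim.eventually hN
  -- Separating `t` from `(b, c)` gives an interval `|t| < δ`; it contains `s * t` for all `s ∈ [0,
  -- 1]`, so the estimate holds along the whole segment.
  rw [nhds_prod_eq] at hev
  obtain ⟨p, hp, q, hq, hpq⟩ := eventually_prod_iff.1 hev
  obtain ⟨δ, hδ, hball⟩ := Metric.eventually_nhds_iff.1 hp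
  filter_upwards [(hb.prodMk_nhds hc).eventually hq, self_mem_nhdsWithin,
    (Metric.ball_mem_nhds (0 : ℝ) hδ : Metric.ball (0 : ℝ) δ ∈ 𝓝 0) |>
      mem_nhdsWithin_of_mem_nhds] with t hqt ht htδ
  have key : ∀ s ∈ Icc (0 : ℝ) 1, (∀ k, HasDirDeriv f (b t + (s * t) • c t) k
      (f' (b t + (s * t) • c t) k)) ∧ ‖f' (b t + (s * t) • c t) (c t) - f' x₀ h‖ ≤ ε / 2 := by
    intro s hs
    refine hpq (x := s * t) (hball ?_) hqt
    rw [Metric.mem_ball, dist_zero_right] at htδ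
    rw [dist_zero_right, norm_mul, Real.norm_of_nonneg hs.1]
    exact (mul_le_of_le_one_left (norm_nonneg t) hs.2).trans_lt htδ
  -- With the expected linear term subtracted, the derivative in `s` is at most `‖t‖ * (ε / 2)`, and
  -- the mean value inequality applies.
  have hder : ∀ s ∈ Icc (0 : ℝ) 1, HasDerivWithinAt
      (fun s : ℝ => f (b t + (s * t) • c t) - (s * t) • f' x₀ h)
      (t • (f' (b t + (s * t) • c t) (c t) - f' x₀ h)) (Icc 0 1) s := by
    intro s hs
    have h1 : HasDerivAt (fun r : ℝ => f (b t + r • c t) - r • f' x₀ h)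
        (f' (b t + (s * t) • c t) (c t) - f' x₀ h) (s * t) := by
      have h0 : HasDerivAt (fun r : ℝ => r • f' x₀ h) (f' x₀ h) (s * t) := by
        simpa using (hasDerivAt_id (s * t)).smul_const (f' x₀ h)
      exact ((key s hs).1 (c t)).hasDerivAt.sub h0
    have h2 : HasDerivAt (fun s : ℝ => s * t) t s := by
      simpa using (hasDerivAt_id s).mul_const t
    exact (h1.scomp s h2).hasDerivWithinAt
  have hbound := norm_image_sub_le_of_norm_deriv_le_segment_01' (C := ‖t‖ * (ε / 2)) hder
    (fun s hs => by
      rw [norm_smul]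
      exact mul_le_mul_of_nonneg_left (key s ⟨hs.1, hs.2.le⟩).2 (norm_nonneg t))
  have ht0 : (t : ℝ) ≠ 0 := ht
  have hrew : t⁻¹ • (f (b t + t • c t) - f (b t)) - f' x₀ h =
      t⁻¹ • ((f (b t + (1 * t) • c t) - (1 * t) • f' x₀ h) -
        (f (b t + (0 * t) • c t) - (0 * t) • f' x₀ h)) := by
    simp only [one_mul, zero_mul, zero_smul, add_zero, sub_zero, smul_sub, smul_smul,
      inv_mul_cancel₀ ht0, one_smul]
    abel
  rw [dist_eq_norm, hrew, norm_smul, norm_inv]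
  have htpos : 0 < ‖t‖ := norm_pos_iff.2 ht0
  calc ‖t‖⁻¹ * _ ≤ ‖t‖⁻¹ * (‖t‖ * (ε / 2)) :=
        mul_le_mul_of_nonneg_left hbound (inv_nonneg.2 htpos.le)
    _ = ε / 2 := by rw [← mul_assoc, inv_mul_cancel₀ htpos.ne', one_mul]
    _ < ε := half_lt_self hε

/-- The chain rule along a differentiable curve. -/
theorem HasContDirDerivNear.hasDirDeriv_comp {E' : Type*} [AddCommGroup E'] [Module ℝ E']
    {f : E → W} {f' : E → E → W} {γ : E' → E} {y k : E'} {v : E}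
    (hf : HasContDirDerivNear f f' (γ y)) (hγ : HasDirDeriv γ y k v) :
    HasDirDeriv (fun z => f (γ z)) y k (f' (γ y) v) := by
  -- Constant base point `γ y`; the moving direction is the difference quotient of `γ`.
  refine (hf.tendsto_strict tendsto_const_nhds hγ).congr' ?_
  filter_upwards [self_mem_nhdsWithin] with t ht
  rw [smul_smul, mul_inv_cancel₀ ht, one_smul, add_sub_cancel]

theorem HasContDirDerivNear.deriv_add {f : E → W} {f' : E → E → W} {x₀ : E}
    (hf : HasContDirDerivNear f f' x₀) (h k : E) : f' x₀ (h + k) = f' x₀ h + f' x₀ k := by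
  refine (hf.hasDirDeriv (h + k)).unique ?_
  have h1 := hf.hasDirDeriv h
  -- The increment along `h + k` splits at `x₀ + t • h`; the second piece has a moving base point,
  -- which is why strict differentiability is needed.
  have h2 := hf.tendsto_strict
    ((tendsto_add_smul_nhds x₀ h).mono_left nhdsWithin_le_nhds) (tendsto_const_nhds (x := k))
  refine (Tendsto.add h1 h2).congr fun t => ?_
  rw [← smul_add, smul_add t h k, add_assoc]
  congr 1
  abel

/-- The derivative at `x₀` of a function with continuous directional derivatives. -/
def HasContDirDerivNear.derivCLM {f : E → W} {f' : E → E → W} {x₀ : E}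
    (hf : HasContDirDerivNear f f' x₀) : E →L[ℝ] W where
  toFun := f' x₀
  map_add' := hf.deriv_add
  map_smul' c h := (hf.hasDirDeriv (c • h)).unique ((hf.hasDirDeriv h).smul c)
  cont := continuous_iff_continuousAt.2 fun h => by
    have h2 : Continuous fun k : E => (x₀, k) := by fun_prop
    exact ContinuousAt.comp (f := fun k : E => (x₀, k)) (hf.continuousAt h) h2.continuousAt

end Chain

/-- The derivative of a local right inverse with respect to a local multiplication with two-sided
unit `e` is `-1`. -/
theorem HasContDirDerivNear.deriv_inverse [TopologicalSpace E] [IsTopologicalAddGroup E]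
    [ContinuousSMul ℝ E] [LocallyConvexSpace ℝ E] [T2Space E]
    {m : E × E → E} {m' : E × E → E × E → E} {e : E} {i : E → E} {ξ ζ : E}
    (hm : HasContDirDerivNear m m' (e, e)) (hl : ∀ᶠ x in 𝓝 e, m (e, x) = x)
    (hr : ∀ᶠ x in 𝓝 e, m (x, e) = x) (hi : HasDirDeriv i e ξ ζ) (hie : i e = e)
    (hmi : ∀ᶠ x in 𝓝 e, m (x, i x) = e) : ζ = -ξ := by
  have hL : HasDirDeriv (fun y => (y, i y)) e ξ (ξ, ζ) := (hasDirDeriv_id e ξ).prodMk hi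
  -- As `e` is a unit on both sides, both partial derivatives of `m` at `(e, e)` are the identity.
  have h1 : ∀ v, m' (e, e) (v, 0) = v := by
    intro v
    refine (hm.hasDirDeriv (v, 0)).unique (f := m) ?_
    have h0 := (hasDirDeriv_id e v).congr_of_eventuallyEq hr
    refine Tendsto.congr (fun t => ?_) h0
    simp
  have h2 : ∀ v, m' (e, e) (0, v) = v := by
    intro v
    refine (hm.hasDirDeriv (0, v)).unique (f := m) ?_
    have h0 := (hasDirDeriv_id e v).congr_of_eventuallyEq hl
    refine Tendsto.congr (fun t => ?_) h0
    simp
  -- The chain rule above needs a normed target, so it is applied after a continuous functional; by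
  -- Hahn–Banach these separate points.
  have key : ∀ l : E →L[ℝ] ℝ, l (ξ + ζ) = 0 := by
    intro l
    have hml := hm.clm_comp l
    have h3 : HasDirDeriv (fun z => l (m (z, i z))) e ξ (l (m' (e, i e) (ξ, ζ))) :=
      HasContDirDerivNear.hasDirDeriv_comp (γ := fun y => (y, i y)) (by simpa [hie] using hml) hL
    have h4 : HasDirDeriv (fun z => l (m (z, i z))) e ξ 0 := by
      have h0 : HasDirDeriv (fun _ : E => l e) e ξ 0 := by
        simp [HasDirDeriv]
      refine h0.congr_of_eventuallyEq ?_
      filter_upwards [hmi] with z hz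
      rw [hz]
    have h5 := hml.deriv_add (ξ, 0) (0, ζ)
    simp only [Prod.mk_add_mk, add_zero, zero_add, h1, h2] at h5
    rw [map_add, ← h5, ← h3.unique h4, hie]
  have h0 : ξ + ζ = 0 := by
    by_contra hne
    obtain ⟨l, hl⟩ := SeparatingDual.exists_ne_zero (R := ℝ) hne
    exact hl (key l)
  exact (neg_eq_of_add_eq_zero_right h0).symm

end Calculus

/-! ### The form on the complexification defined by a real linear map into a Hilbert space -/

section ComplexifiedForm

variable {V H : Type*} [AddCommGroup V] [Module ℝ V] [TopologicalSpace V]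
  [NormedAddCommGroup H] [InnerProductSpace ℂ H]

/-- The complex linear extension `ξ + iη ↦ A ξ + i A η` of a real linear map. -/
def complexExtension (A : V →L[ℝ] H) : Complexified V →ₗ[ℂ] H where
  toFun ζ := A ζ.re + Complex.I • A ζ.im
  map_add' a b := by simp; abel
  map_smul' z a := by
    have h : ∀ (r : ℝ) (v : H), r • v = (r : ℂ) • v := fun _ _ => rfl
    conv_rhs => rw [← Complex.re_add_im z]
    simp only [Complexified.re_smul, Complexified.im_smul, map_sub, map_add, map_smul, h,
      RingHom.id_apply]
    match_scalars <;> ring_nf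
    rw [Complex.I_sq]; ring

/-- The antilinear extension `ξ + iη ↦ A ξ - i A η` of a real linear map. -/
def complexConjExtension (A : V →L[ℝ] H) : Complexified V →ₗ⋆[ℂ] H where
  toFun ζ := A ζ.re - Complex.I • A ζ.im
  map_add' a b := by simp; abel
  map_smul' z a := by
    have h : ∀ (r : ℝ) (v : H), r • v = (r : ℂ) • v := fun _ _ => rfl
    have hz : (starRingEnd ℂ) z = z.re - z.im * Complex.I := by
      apply Complex.ext <;> simp
    simp only [Complexified.re_smul, Complexified.im_smul, map_sub, map_add, map_smul, h, hz]
    match_scalars <;> ring_nf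
    rw [Complex.I_sq]; ring

theorem continuous_complexExtension (A : V →L[ℝ] H) : Continuous (complexExtension A) := by
  have h1 : Continuous fun ζ : Complexified V => ζ.re := continuous_fst (X := V) (Y := V)
  have h2 : Continuous fun ζ : Complexified V => ζ.im := continuous_snd (X := V) (Y := V)
  exact (A.continuous.comp h1).add ((A.continuous.comp h2).const_smul _)

theorem continuous_complexConjExtension (A : V →L[ℝ] H) : Continuous (complexConjExtension A) := by
  have h1 : Continuous fun ζ : Complexified V => ζ.re := continuous_fst (X := V) (Y := V)
  have h2 : Continuous fun ζ : Complexified V => ζ.im := continuous_snd (X := V) (Y := V)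
  exact (A.continuous.comp h1).sub ((A.continuous.comp h2).const_smul _)

/-- The form `2 ⟨A ζ, A ζ'⟩ + ⟨A ζ̄', A ζ̄⟩`. On `V` it has the same imaginary part
as `⟨A ξ, A η⟩`; the second term makes its kernel invariant under complex conjugation, which
fails in general for the kernel of `⟨A ζ, A ζ'⟩` itself. -/
def orbitForm (A : V →L[ℝ] H) : Complexified V →ₗ⋆[ℂ] Complexified V →ₗ[ℂ] ℂ :=
  LinearMap.mk₂'ₛₗ (starRingEnd ℂ) (RingHom.id ℂ)
    (fun a b => 2 * inner ℂ (complexExtension A a) (complexExtension A b) +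
      inner ℂ (complexConjExtension A b) (complexConjExtension A a))
    (fun a b c => by simp only [map_add, inner_add_left, inner_add_right]; ring)
    (fun z a b => by
      simp only [map_smulₛₗ, inner_smul_left, inner_smul_right, RingHom.id_apply, smul_eq_mul]
      ring)
    (fun a b c => by simp only [map_add, inner_add_left, inner_add_right]; ring)
    (fun z a b => by
      simp only [map_smulₛₗ, inner_smul_left, inner_smul_right, RingHom.id_apply, smul_eq_mul,
        Complex.conj_conj]
      ring)

theorem orbitForm_apply (A : V →L[ℝ] H) (a b : Complexified V) :
    orbitForm A a b = 2 * inner ℂ (complexExtension A a) (complexExtension A b) +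
      inner ℂ (complexConjExtension A b) (complexConjExtension A a) := rfl

theorem orbitForm_self (A : V →L[ℝ] H) (a : Complexified V) :
    orbitForm A a a =
      ((2 * ‖complexExtension A a‖ ^ 2 + ‖complexConjExtension A a‖ ^ 2 : ℝ) : ℂ) := by
  rw [orbitForm_apply, inner_self_eq_norm_sq_to_K, inner_self_eq_norm_sq_to_K]
  push_cast
  rfl

theorem isContPosSemidef_orbitForm (A : V →L[ℝ] H) : IsContPosSemidef (orbitForm A) where
  continuous := by
    simp only [orbitForm_apply]
    have h1 := continuous_complexExtension A
    have h2 := continuous_complexConjExtension A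
    fun_prop
  re_nonneg a := by
    rw [orbitForm_self, Complex.ofReal_re]
    positivity
  im_eq_zero a := by rw [orbitForm_self, Complex.ofReal_im]

theorem orbitForm_ofReal (A : V →L[ℝ] H) (ξ η : V) :
    orbitForm A (Complexified.ofReal ξ) (Complexified.ofReal η) =
      2 * inner ℂ (A ξ) (A η) + inner ℂ (A η) (A ξ) := by
  simp [orbitForm_apply, complexExtension, complexConjExtension, Complexified.ofReal]

/-- Swapping the arguments conjugates the inner product, so the weights 2 and 1 combine to 2 - 1 =
1. -/
theorem im_orbitForm_ofReal (A : V →L[ℝ] H) (ξ η : V) :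
    (orbitForm A (Complexified.ofReal ξ) (Complexified.ofReal η)).im =
      (inner ℂ (A ξ) (A η)).im := by
  have h : (inner ℂ (A η) (A ξ)).im = -(inner ℂ (A ξ) (A η)).im := by
    rw [← inner_conj_symm, Complex.conj_im]
  rw [orbitForm_ofReal, Complex.add_im, h, two_mul, Complex.add_im]
  ring

theorem norm_le_sqrt_orbitForm (A : V →L[ℝ] H) (ξ : V) :
    ‖A ξ‖ ≤ √(orbitForm A (Complexified.ofReal ξ) (Complexified.ofReal ξ)).re := by
  refine Real.le_sqrt_of_sq_le ?_
  rw [orbitForm_self, Complex.ofReal_re]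
  simp only [complexExtension, complexConjExtension, Complexified.ofReal, LinearMap.coe_mk,
    AddHom.coe_mk, Complexified.re_mk, Complexified.im_mk, map_zero, smul_zero, add_zero, sub_zero]
  linarith [sq_nonneg (‖A ξ‖)]

/-- Pairing `ζ` with itself gives a vanishing sum of two squared norms, hence both `A ζ.re ± i A
ζ.im` are zero. -/
theorem eq_zero_of_mem_sesqKer_orbitForm (A : V →L[ℝ] H) {ζ : Complexified V}
    (hζ : ζ ∈ sesqKer (orbitForm A)) : A ζ.re = 0 ∧ A ζ.im = 0 := by
  have h := hζ ζ
  rw [orbitForm_self, Complex.ofReal_eq_zero] at h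
  have h1 : A ζ.re + Complex.I • A ζ.im = 0 := by
    have : ‖complexExtension A ζ‖ ^ 2 = 0 := by
      linarith [sq_nonneg (‖complexExtension A ζ‖), sq_nonneg (‖complexConjExtension A ζ‖)]
    exact norm_eq_zero.1 (pow_eq_zero_iff two_ne_zero |>.1 this)
  have h2 : A ζ.re - Complex.I • A ζ.im = 0 := by
    have : ‖complexConjExtension A ζ‖ ^ 2 = 0 := by
      linarith [sq_nonneg (‖complexExtension A ζ‖), sq_nonneg (‖complexConjExtension A ζ‖)]
    exact norm_eq_zero.1 (pow_eq_zero_iff two_ne_zero |>.1 this)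
  have h3 : A ζ.re = Complex.I • A ζ.im := sub_eq_zero.1 h2
  rw [h3, ← two_smul ℂ, smul_smul, smul_eq_zero] at h1
  have h4 : A ζ.im = 0 := h1.resolve_left (by simp)
  exact ⟨by rw [h3, h4, smul_zero], h4⟩

/-- Cauchy–Schwarz in `H`; the form dominates `‖A ξ‖ ^ 2` on real vectors. -/
theorem half_abs_neg_two_mul_im_inner_le (A : V →L[ℝ] H) (ξ η : V) :
    (1 / 2 : ℝ) * |(-2) * (inner ℂ (A ξ) (A η)).im| ≤
      √(orbitForm A (Complexified.ofReal ξ) (Complexified.ofReal ξ)).re *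
        √(orbitForm A (Complexified.ofReal η) (Complexified.ofReal η)).re := by
  have h1 : |(inner ℂ (A ξ) (A η)).im| ≤ ‖A ξ‖ * ‖A η‖ :=
    (Complex.abs_im_le_norm _).trans (norm_inner_le_norm _ _)
  have h2 := mul_le_mul (norm_le_sqrt_orbitForm A ξ) (norm_le_sqrt_orbitForm A η)
    (norm_nonneg _) (Real.sqrt_nonneg _)
  rw [abs_mul, abs_neg, abs_two]
  linarith

end ComplexifiedForm

/-! ### Coboundaries -/

section Cohomology

variable {𝔤 : Type*} [LieRing 𝔤] [LieAlgebra ℝ 𝔤] [TopologicalSpace 𝔤]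
  [IsLocallyConvexLieAlgebra 𝔤]

/-- The coboundary `δβ (x, y) = -β ([x, y])`. -/
def coboundary (β : 𝔤 →L[ℝ] ℝ) : ContTwoCocycles 𝔤 where
  val x y := -β ⁅x, y⁆
  property := by
    refine ⟨fun x => ⟨fun a b => ?_, fun r a => ?_⟩, fun y => ⟨fun a b => ?_, fun r a => ?_⟩,
      (β.continuous.comp IsLocallyConvexLieAlgebra.continuous_lie).neg, fun x => by simp,
      fun x y z => ?_⟩
    · change -β ⁅x, a + b⁆ = -β ⁅x, a⁆ + -β ⁅x, b⁆
      rw [lie_add, map_add, neg_add]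
    · change -β ⁅x, r • a⁆ = r • -β ⁅x, a⁆
      rw [lie_smul, map_smul, smul_neg]
    · change -β ⁅a + b, y⁆ = -β ⁅a, y⁆ + -β ⁅b, y⁆
      rw [add_lie, map_add, neg_add]
    · change -β ⁅r • a, y⁆ = r • -β ⁅a, y⁆
      rw [smul_lie, map_smul, smul_neg]
    · rw [← neg_add, ← neg_add, ← map_add, ← map_add, neg_eq_zero]
      have h := lie_jacobi x y z
      rw [← lie_skew ⁅x, y⁆ z, ← lie_skew ⁅y, z⁆ x, ← lie_skew ⁅z, x⁆ y]
      rw [show -⁅z, ⁅x, y⁆⁆ + -⁅x, ⁅y, z⁆⁆ + -⁅y, ⁅z, x⁆⁆ =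
        -(⁅x, ⁅y, z⁆⁆ + ⁅y, ⁅z, x⁆⁆ + ⁅z, ⁅x, y⁆⁆) by abel, h, neg_zero, map_zero]

theorem cohomClass_add_coboundary (ω : ContTwoCocycles 𝔤) (β : 𝔤 →L[ℝ] ℝ) :
    cohomClass (ω + coboundary β) = cohomClass ω := by
  have h : cohomClass (coboundary β) = 0 :=
    (Submodule.Quotient.mk_eq_zero _).2 ⟨β, fun _ _ => rfl⟩
  rw [cohomClass, map_add]
  exact (congrArg _ h).trans (add_zero _)

end Cohomology

/-! ### Orbits of rays in charts of the projective space -/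

section Projective

variable {H : Type*} [NormedAddCommGroup H] [InnerProductSpace ℂ H]

/-- The chart and its domain are defined through the chosen `rep`. They are homogeneous of degree
zero in the representative, so any vector on the ray may replace it, here and in `projChart_mk`. -/
theorem mk_mem_projChartDomain {φ v : H} (hv : v ≠ 0) :
    Projectivization.mk ℂ v hv ∈ projChartDomain φ ↔ inner ℂ φ v ≠ 0 := by
  obtain ⟨a, ha⟩ := Projectivization.exists_smul_eq_mk_rep ℂ v hv
  have ha0 : (a : ℂ) ≠ 0 := a.ne_zero
  rw [projChartDomain, mem_ofPred_eq, ← ha, Units.smul_def, inner_smul_right]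
  simp [ha0]

theorem projChart_mk {φ v : H} (hv : v ≠ 0) :
    projChart φ (Projectivization.mk ℂ v hv) = (inner ℂ φ v)⁻¹ • v - φ := by
  obtain ⟨a, ha⟩ := Projectivization.exists_smul_eq_mk_rep ℂ v hv
  have ha0 : (a : ℂ) ≠ 0 := a.ne_zero
  rw [projChart, ← ha, Units.smul_def, inner_smul_right, smul_smul, mul_inv, mul_comm, ← mul_assoc,
    mul_inv_cancel₀ ha0, one_mul]

theorem isOpen_projChartDomain (φ : H) : IsOpen (projChartDomain φ) := by
  refine isOpen_coinduced.2 ?_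
  have h : (fun v : {v : H // v ≠ 0} => Projectivization.mk ℂ v.1 v.2) ⁻¹' projChartDomain φ =
      {v : {v : H // v ≠ 0} | inner ℂ φ v.1 ≠ 0} := by
    ext v
    exact mk_mem_projChartDomain v.2
  rw [h]
  exact isOpen_ne_fun (by fun_prop) continuous_const

theorem inner_projChart_mk {φ v : H} (hφ : ‖φ‖ = 1) (hv : v ≠ 0) (h : inner ℂ φ v ≠ 0) :
    inner ℂ φ (projChart φ (Projectivization.mk ℂ v hv)) = 0 := by
  rw [projChart_mk, inner_sub_right, inner_smul_right, inv_mul_cancel₀ h,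
    inner_self_eq_norm_sq_to_K, hφ]
  simp

theorem apply_ne_zero (U : H ≃ₗᵢ[ℂ] H) {ψ : H} (hψ : ψ ≠ 0) : U ψ ≠ 0 :=
  U.toLinearEquiv.map_ne_zero_iff.2 hψ

variable {G : Type*} [Group G] (ρ : G →* ProjUnitary H)

theorem rayOrbit_of_mem_sharpGroup {ψ : H} (hψ : ψ ≠ 0) (γ : sharpGroup ρ) :
    rayOrbit ρ (Projectivization.mk ℂ ψ hψ) γ.1.1 =
      Projectivization.mk ℂ (γ.1.2 ψ) (apply_ne_zero _ hψ) := by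
  have h : ρ γ.1.1 = QuotientGroup.mk' (scalarUnitary H).range γ.1.2 := γ.2
  rw [rayOrbit, h]
  rfl

theorem rayOrbit_one (ρ : G →* ProjUnitary H) {φ : H} (hφ : φ ≠ 0) :
    rayOrbit ρ (Projectivization.mk ℂ φ hφ) 1 = Projectivization.mk ℂ φ hφ :=
  rayOrbit_of_mem_sharpGroup ρ hφ 1

theorem sharpLift_spec {ψ : H} (hψ : ψ ≠ 0) {g : G}
    (hg : rayOrbit ρ (Projectivization.mk ℂ ψ hψ) g ∈ projChartDomain ψ) :
    (sharpLift ρ ψ g).1.1 = g ∧ 0 < (inner ℂ ψ ((sharpLift ρ ψ g).1.2 ψ)).re ∧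
      (inner ℂ ψ ((sharpLift ρ ψ g).1.2 ψ)).im = 0 := by
  refine Classical.epsilon_spec (p := fun γ : sharpGroup ρ =>
    γ.1.1 = g ∧ 0 < (inner ℂ ψ (γ.1.2 ψ)).re ∧ (inner ℂ ψ (γ.1.2 ψ)).im = 0) ?_
  obtain ⟨U, hU⟩ := QuotientGroup.mk'_surjective (scalarUnitary H).range (ρ g)
  set γ : sharpGroup ρ := ⟨(g, U), hU.symm⟩
  rw [show g = γ.1.1 from rfl, rayOrbit_of_mem_sharpGroup, mk_mem_projChartDomain] at hg
  set w : ℂ := inner ℂ ψ (U ψ) with hw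
  have hw0 : w ≠ 0 := hg
  -- Rotating an arbitrary lift by `exp (-i arg w)` turns its matrix coefficient `w` into `‖w‖`.
  refine ⟨γ * circleToSharp ρ (Circle.exp (-w.arg)), mul_one g, ?_⟩
  have h : inner ℂ ψ ((γ * circleToSharp ρ (Circle.exp (-w.arg))).1.2 ψ) = (‖w‖ : ℂ) := by
    change inner ℂ ψ (U ((Circle.exp (-w.arg) : ℂ) • ψ)) = (‖w‖ : ℂ)
    rw [map_smul, inner_smul_right, ← hw, Circle.coe_exp]
    conv_lhs => rw [← Complex.norm_mul_exp_arg_mul_I w]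
    rw [mul_left_comm, ← Complex.exp_add]
    simp
  rw [h]
  exact ⟨by simpa using hw0, by simp⟩

/-- For a unit vector `φ`, an element of `G♯` with `⟨φ, U φ⟩ > 0` satisfies `U φ = c (φ + u)`
with `u` the coordinate of `[U φ]` and `c > 0`. -/
theorem apply_eq_smul_projChart {φ : H} (hφ : φ ≠ 0) (γ : sharpGroup ρ)
    (hre : 0 < (inner ℂ φ (γ.1.2 φ)).re) (him : (inner ℂ φ (γ.1.2 φ)).im = 0) :
    γ.1.2 φ = ((inner ℂ φ (γ.1.2 φ)).re : ℂ) •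
      (φ + projChart φ (rayOrbit ρ (Projectivization.mk ℂ φ hφ) γ.1.1)) := by
  have h : ((inner ℂ φ (γ.1.2 φ)).re : ℂ) = inner ℂ φ (γ.1.2 φ) := by
    apply Complex.ext <;> simp [him]
  have h0 : inner ℂ φ (γ.1.2 φ) ≠ 0 := by
    intro h0
    rw [h0] at hre
    simp at hre
  rw [rayOrbit_of_mem_sharpGroup, projChart_mk, add_sub_cancel, h, smul_smul, mul_inv_cancel₀ h0,
    one_smul]

theorem inner_symm_apply (U : H ≃ₗᵢ[ℂ] H) (v w : H) : inner ℂ (U⁻¹ v) w = inner ℂ v (U w) := by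
  rw [← U.inner_map_map (U⁻¹ v) w]
  congr 1
  exact U.apply_symm_apply v

/-- The coefficient `⟨φ, U⁻¹ φ⟩` is the conjugate of `⟨φ, U φ⟩`, because `U` is unitary. -/
theorem rayOrbit_inv_mem {φ : H} (hφ : φ ≠ 0) {g : G}
    (hg : rayOrbit ρ (Projectivization.mk ℂ φ hφ) g ∈ projChartDomain φ) :
    rayOrbit ρ (Projectivization.mk ℂ φ hφ) g⁻¹ ∈ projChartDomain φ := by
  obtain ⟨h1, h2, h3⟩ := sharpLift_spec ρ hφ hg
  have h : g⁻¹ = ((sharpLift ρ φ g)⁻¹).1.1 := by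
    conv_lhs => rw [← h1]
    rfl
  rw [h, rayOrbit_of_mem_sharpGroup, mk_mem_projChartDomain]
  intro h0
  have h4 := inner_symm_apply (sharpLift ρ φ g).1.2 φ φ
  have h5 : inner ℂ φ ((sharpLift ρ φ g).1.2⁻¹ φ) = 0 := h0
  rw [← inner_conj_symm, h5, map_zero] at h4
  rw [← h4] at h2
  simp at h2

/-- The multiplication of `G♯` in the coordinates given by a unit vector. -/
theorem arg_inner_sharpLift_mul {φ : H} (hφ : ‖φ‖ = 1) (hφ0 : φ ≠ 0) {g k : G}
    (hg : rayOrbit ρ (Projectivization.mk ℂ φ hφ0) g ∈ projChartDomain φ)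
    (hk : rayOrbit ρ (Projectivization.mk ℂ φ hφ0) k ∈ projChartDomain φ) :
    (inner ℂ φ ((sharpLift ρ φ g * sharpLift ρ φ k).1.2 φ)).arg =
      (1 + inner ℂ (projChart φ (rayOrbit ρ (Projectivization.mk ℂ φ hφ0) g⁻¹))
        (projChart φ (rayOrbit ρ (Projectivization.mk ℂ φ hφ0) k))).arg := by
  obtain ⟨hg1, hg2, hg3⟩ := sharpLift_spec ρ hφ0 hg
  obtain ⟨hk1, hk2, hk3⟩ := sharpLift_spec ρ hφ0 hk
  have hk4 := apply_eq_smul_projChart ρ hφ0 _ hk2 hk3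
  have hinv : inner ℂ φ ((sharpLift ρ φ g)⁻¹.1.2 φ) =
      (starRingEnd ℂ) (inner ℂ φ ((sharpLift ρ φ g).1.2 φ)) := by
    rw [← inner_symm_apply, inner_conj_symm]
    rfl
  have hg2' : 0 < (inner ℂ φ ((sharpLift ρ φ g)⁻¹.1.2 φ)).re := by rw [hinv]; exact hg2
  have hg3' : (inner ℂ φ ((sharpLift ρ φ g)⁻¹.1.2 φ)).im = 0 := by
    rw [hinv, Complex.conj_im, hg3, neg_zero]
  have hg4 := apply_eq_smul_projChart ρ hφ0 _ hg2' hg3'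
  have hginv : (sharpLift ρ φ g)⁻¹.1.1 = g⁻¹ := by
    conv_rhs => rw [← hg1]
    rfl
  rw [hginv] at hg4
  rw [hk1] at hk4
  have hmul : inner ℂ φ ((sharpLift ρ φ g * sharpLift ρ φ k).1.2 φ) =
      inner ℂ ((sharpLift ρ φ g)⁻¹.1.2 φ) ((sharpLift ρ φ k).1.2 φ) :=
    (inner_symm_apply (sharpLift ρ φ g).1.2 φ ((sharpLift ρ φ k).1.2 φ)).symm
  have horth : ∀ l : G, rayOrbit ρ (Projectivization.mk ℂ φ hφ0) l ∈ projChartDomain φ →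
      inner ℂ φ (projChart φ (rayOrbit ρ (Projectivization.mk ℂ φ hφ0) l)) = 0 := by
    intro l hl
    obtain ⟨h, -, -⟩ := sharpLift_spec ρ hφ0 hl
    rw [← h, rayOrbit_of_mem_sharpGroup] at hl ⊢
    exact inner_projChart_mk hφ _ ((mk_mem_projChartDomain _).1 hl)
  have h1 := horth k hk
  have h2 := horth g⁻¹ (rayOrbit_inv_mem ρ hφ0 hg)
  have h3 : inner ℂ (projChart φ (rayOrbit ρ (Projectivization.mk ℂ φ hφ0) g⁻¹)) φ = 0 := by
    rw [← inner_conj_symm, h2, map_zero]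
  -- The positive factors do not change the argument; the cross terms then vanish because both
  -- coordinates are orthogonal to `φ`.
  rw [hmul, hg4, hk4, inner_smul_left, inner_smul_right, Complex.conj_ofReal,
    Complex.arg_real_mul _ hg2', Complex.arg_real_mul _ hk2]
  congr 1
  rw [inner_add_left, inner_add_right, inner_add_right, h1, h3, inner_self_eq_norm_sq_to_K, hφ]
  simp

/-- The lift depends only on the ray. -/
theorem sharpLift_smul (ψ : H) {r : ℝ} (hr : 0 < r) (g : G) :
    sharpLift ρ ((r : ℂ) • ψ) g = sharpLift ρ ψ g := by
  unfold sharpLift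
  congr 1
  funext γ
  have h : inner ℂ ((r : ℂ) • ψ) (γ.1.2 ((r : ℂ) • ψ)) =
      ((r * r : ℝ) : ℂ) * inner ℂ ψ (γ.1.2 ψ) := by
    rw [map_smul, inner_smul_left, inner_smul_right, Complex.conj_ofReal]
    push_cast
    ring
  rw [h, Complex.re_ofReal_mul, Complex.im_ofReal_mul]
  have hr2 : 0 < r * r := mul_pos hr hr
  simp [hr.ne', mul_pos_iff_of_pos_left hr2]

theorem sharpChart_smul {𝔤 : Type*} [TopologicalSpace 𝔤] [TopologicalSpace G] [ChartedSpace 𝔤 G]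
    (ψ : H) {r : ℝ} (hr : 0 < r) :
    (sharpChart ρ ((r : ℂ) • ψ) : sharpGroup ρ → 𝔤 × ℝ) = sharpChart ρ ψ := by
  funext γ
  have h : inner ℂ ((r : ℂ) • ψ) (γ.1.2 ((r : ℂ) • ψ)) =
      ((r * r : ℝ) : ℂ) * inner ℂ ψ (γ.1.2 ψ) := by
    rw [map_smul, inner_smul_left, inner_smul_right, Complex.conj_ofReal]
    push_cast
    ring
  rw [sharpChart, sharpChart, h, Complex.arg_real_mul _ (mul_pos hr hr)]

/-- Allows passage to a unit vector: rescaling by `r` multiplies `⟨ψ, U ψ⟩` by `r * r > 0`, which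
affects neither the lift nor the argument. -/
theorem sharpBracket_smul {𝔤 : Type*} [AddCommGroup 𝔤] [Module ℝ 𝔤] [TopologicalSpace 𝔤]
    [TopologicalSpace G] [ChartedSpace 𝔤 G] (ψ : H) {r : ℝ} (hr : 0 < r) :
    (sharpBracket ρ ((r : ℂ) • ψ) : 𝔤 × ℝ → 𝔤 × ℝ → 𝔤 × ℝ) = sharpBracket ρ ψ := by
  have h : (sharpChartInv ρ ((r : ℂ) • ψ) : 𝔤 × ℝ → sharpGroup ρ) = sharpChartInv ρ ψ := by
    funext p
    rw [sharpChartInv, sharpChartInv, sharpLift_smul ρ ψ hr]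
  rw [sharpBracket, sharpBracket, h, sharpChart_smul ρ ψ hr]

end Projective

/-! ### The Lie bracket of the central extension -/

section Bracket

theorem HasDirDeriv.of_hasDerivAt {E F : Type*} [AddCommGroup E] [Module ℝ E]
    [NormedAddCommGroup F] [NormedSpace ℝ F] {f : E → F} {x h : E} {v : F}
    (hf : HasDerivAt (fun s : ℝ => f (x + s • h)) v 0) : HasDirDeriv f x h v := by
  rw [hasDerivAt_iff_tendsto_slope_zero] at hf
  simpa [HasDirDeriv] using hf

/-- Directions `(h, 0)` stay in the slice of phase zero, so brackets of lifts `(ξ, 0)` only involve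
products of positive lifts. -/
theorem hasDirDeriv_mk_zero_iff {E F : Type*} [AddCommGroup E] [Module ℝ E]
    [AddCommGroup F] [Module ℝ F] [TopologicalSpace F] {f : E × ℝ → F} {x h : E} {v : F} :
    HasDirDeriv f (x, 0) (h, 0) v ↔ HasDirDeriv (fun y => f (y, 0)) x h v := by
  simp [HasDirDeriv]

/-- Here `arg = Im log`, and `log` has derivative 1 at the point 1, away from the branch cut. -/
theorem HasDirDeriv.arg_one_add_inner {E H : Type*} [AddCommGroup E] [Module ℝ E]
    [NormedAddCommGroup H] [InnerProductSpace ℂ H] (a : H) {u : E → H} {x h : E} {v : H}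
    (hu : HasDirDeriv u x h v) (hx : u x = 0) :
    HasDirDeriv (fun y => (1 + inner ℂ a (u y)).arg) x h (inner ℂ a v).im := by
  refine .of_hasDerivAt ?_
  have hu' : HasDirDeriv u (x + (0 : ℝ) • h) h v := by simpa using hu
  have h0 : HasDerivAt (fun s : ℝ => inner ℂ a (u (x + s • h))) (inner ℂ a v) 0 :=
    (hu'.clm_comp ((innerSL ℂ a).restrictScalars ℝ)).hasDerivAt
  have h1 : (1 : ℂ) + inner ℂ a (u (x + (0 : ℝ) • h)) = 1 := by simp [hx]
  have h2 := (h0.const_add 1).clog_real (by rw [h1]; exact Complex.one_mem_slitPlane)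
  rw [h1, div_one] at h2
  have h3 := Complex.imCLM.hasFDerivAt.comp_hasDerivAt (0 : ℝ) h2
  simpa only [Function.comp_def, Complex.imCLM_apply, Complex.log_im] using h3

variable {𝔤 : Type*} [LieRing 𝔤] [LieAlgebra ℝ 𝔤] [TopologicalSpace 𝔤]
  [IsLocallyConvexLieAlgebra 𝔤]
  {G : Type*} [Group G] [TopologicalSpace G] [ChartedSpace 𝔤 G] [IsLocallyConvexLieGroup 𝔤 G]
  {H : Type*} [NormedAddCommGroup H] [InnerProductSpace ℂ H]

/-- The Lie bracket of `G♯` in the chart given by a unit vector on a smooth ray. -/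
theorem exists_sharpBracket_eq (hG : IsLieAlgebraOf 𝔤 G) (ρ : G →* ProjUnitary H) {φ : H}
    (hφ : ‖φ‖ = 1) (hφ0 : φ ≠ 0) (hsm : IsSmoothRay 𝔤 ρ (Projectivization.mk ℂ φ hφ0)) :
    ∃ A : 𝔤 →L[ℝ] H, ∀ ξ η : 𝔤, sharpBracket ρ φ (ξ, 0) (η, 0) =
      (⁅ξ, η⁆, -2 * (inner ℂ (A ξ) (A η)).im) := by
  set r := Projectivization.mk ℂ φ hφ0 with hr
  set e := chartAt 𝔤 (1 : G) with he
  have hea : e ∈ atlas 𝔤 G := chart_mem_atlas 𝔤 1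
  set x₀ : 𝔤 := e 1 with hx₀
  have h1s : (1 : G) ∈ e.source := mem_chart_source 𝔤 1
  have hx₀t : x₀ ∈ e.target := e.map_source h1s
  have hsymm : e.symm x₀ = 1 := e.left_inv h1s
  -- the orbit map in charts
  set u : 𝔤 → H := fun x => projChart φ (rayOrbit ρ r (e.symm x)) with hu
  set O : Set 𝔤 := {x | x ∈ e.target ∧ e.symm x ∈ rayOrbit ρ r ⁻¹' projChartDomain φ} with hO
  have hOo : IsOpen O := e.isOpen_inter_preimage_symm ((isOpen_projChartDomain φ).preimage hsm.1)
  have hφφ : inner ℂ φ φ = 1 := by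
    rw [inner_self_eq_norm_sq_to_K, hφ]
    simp
  have hx₀O : x₀ ∈ O := by
    refine ⟨hx₀t, ?_⟩
    rw [hsymm, mem_preimage, rayOrbit_one, mk_mem_projChartDomain, hφφ]
    exact one_ne_zero
  have hu0 : u x₀ = 0 := by
    change projChart φ (rayOrbit ρ r (e.symm x₀)) = 0
    rw [hsymm, rayOrbit_one, projChart_mk, hφφ, inv_one, one_smul, sub_self]
  obtain ⟨u', -, hu', -⟩ := BSmoothOn.exists_deriv (hsm.2 φ hφ e hea) hOo
  have hux := hu' x₀ hx₀O
  set A : 𝔤 →L[ℝ] H := hux.derivCLM with hA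
  -- multiplication
  set m : 𝔤 × 𝔤 → 𝔤 := fun p => e (e.symm p.1 * e.symm p.2) with hm
  set W : Set (𝔤 × 𝔤) :=
    {p | p.1 ∈ e.target ∧ p.2 ∈ e.target ∧ e.symm p.1 * e.symm p.2 ∈ e.source} with hW
  have hWo : IsOpen W := by
    have hc : ContinuousOn (fun p : 𝔤 × 𝔤 => e.symm p.1 * e.symm p.2) (e.target ×ˢ e.target) :=
      (e.continuousOn_symm.comp continuousOn_fst fun p hp => hp.1).mul
        (e.continuousOn_symm.comp continuousOn_snd fun p hp => hp.2)
    have := hc.isOpen_inter_preimage (e.open_target.prod e.open_target) e.open_source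
    convert this using 1
    ext p
    simp [hW, and_assoc]
  have hx₀W : (x₀, x₀) ∈ W := ⟨hx₀t, hx₀t, by simpa [hsymm] using h1s⟩
  obtain ⟨m', m'', hm', hm''⟩ :=
    BSmoothOn.exists_deriv (IsLocallyConvexLieGroup.smooth_mul e hea e hea e hea) hWo
  -- inversion
  set i : 𝔤 → 𝔤 := fun x => e (e.symm x)⁻¹ with hi
  set I : Set 𝔤 := {x | x ∈ e.target ∧ (e.symm x)⁻¹ ∈ e.source} with hI
  have hIo : IsOpen I := e.continuousOn_symm.inv.isOpen_inter_preimage e.open_target e.open_source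
  have hx₀I : x₀ ∈ I := ⟨hx₀t, by simpa [hsymm] using h1s⟩
  have hix₀ : i x₀ = x₀ := by
    change e (e.symm x₀)⁻¹ = x₀
    rw [hsymm, inv_one]
  obtain ⟨i', -, hi', -⟩ :=
    BSmoothOn.exists_deriv (IsLocallyConvexLieGroup.smooth_inv e hea e hea) hIo
  have hid : ∀ ξ, HasDirDeriv i x₀ ξ (-ξ) := by
    intro ξ
    have h := (hi' x₀ hx₀I).hasDirDeriv ξ
    rwa [← (hm' _ hx₀W).deriv_inverse ?_ ?_ h hix₀ ?_]
    · filter_upwards [e.open_target.mem_nhds hx₀t] with x hx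
      simp [hsymm, e.right_inv hx]
    · filter_upwards [e.open_target.mem_nhds hx₀t] with x hx
      simp [hsymm, e.right_inv hx]
    · filter_upwards [hIo.mem_nhds hx₀I] with x hx
      simp [e.left_inv hx.2, hx₀]
  have hOev : ∀ᶠ x in 𝓝 x₀, x ∈ O := hOo.mem_nhds hx₀O
  have hIev : ∀ᶠ x in 𝓝 x₀, x ∈ I := hIo.mem_nhds hx₀I
  have hWev : ∀ᶠ x in 𝓝 x₀, (x, x₀) ∈ W := by
    have hc : Continuous fun x : 𝔤 => (x, x₀) := by fun_prop
    exact hc.continuousAt.eventually (hWo.mem_nhds hx₀W)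
  -- first derivatives of the multiplications
  have hmd : ∀ x, (x, x₀) ∈ W → ∀ η, HasDirDeriv (fun y => m (x, y)) x₀ η (m' (x, x₀) (0, η)) := by
    intro x hx η
    refine ((hm' _ hx).hasDirDeriv (0, η)).congr fun t => ?_
    simp [hm]
  have hmd2 : ∀ ξ η, HasDirDeriv (fun x => m' (x, x₀) (0, η)) x₀ ξ
      (m'' (x₀, x₀) (0, η) (ξ, 0)) := by
    intro ξ η
    refine (hm'' _ hx₀W (0, η) (ξ, 0)).congr fun t => ?_
    simp
  set M : 𝔤 × ℝ → 𝔤 × ℝ → 𝔤 × ℝ :=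
    fun p q => sharpChart ρ φ (sharpChartInv ρ φ p * sharpChartInv ρ φ q) with hM
  have hMeq : ∀ x ∈ O, x ∈ I → ∀ y ∈ O, M (x, 0) (y, 0) =
      (m (x, y), (1 + inner ℂ (u (i x)) (u y)).arg) := by
    intro x hx hxI y hy
    have h0 : circleToSharp ρ (Circle.exp 0) = 1 := by
      rw [Circle.exp_zero]
      exact Subtype.ext (Prod.ext rfl (map_one (scalarUnitary H)))
    have hxs : sharpChartInv ρ φ (x, (0 : ℝ)) = sharpLift ρ φ (e.symm x) := by
      rw [sharpChartInv, h0, mul_one]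
    have hys : sharpChartInv ρ φ (y, (0 : ℝ)) = sharpLift ρ φ (e.symm y) := by
      rw [sharpChartInv, h0, mul_one]
    have h2 := arg_inner_sharpLift_mul ρ hφ hφ0 hx.2 hy.2
    change sharpChart ρ φ (sharpChartInv ρ φ (x, 0) * sharpChartInv ρ φ (y, 0)) = _
    rw [hxs, hys, sharpChart, h2]
    refine Prod.ext ?_ ?_
    · change e ((sharpLift ρ φ (e.symm x)).1.1 * (sharpLift ρ φ (e.symm y)).1.1) = _
      rw [(sharpLift_spec ρ hφ0 hx.2).1, (sharpLift_spec ρ hφ0 hy.2).1]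
    · simp only [hu, hi, e.left_inv hxI.2, hr]
  -- The formula is needed on a neighbourhood of `x₀`, since it is differentiated again in `x`.
  have hMd : ∀ η, ∀ᶠ x in 𝓝 x₀, dirDeriv (M (x, 0)) (x₀, 0) (η, 0) =
      (m' (x, x₀) (0, η), (inner ℂ (u (i x)) (A η)).im) := by
    intro η
    filter_upwards [hOev, hIev, hWev] with x hxO hxI hxW
    refine (hasDirDeriv_mk_zero_iff.2 ?_).dirDeriv_eq
    refine ((hmd x hxW η).prodMk
      ((hux.hasDirDeriv η).arg_one_add_inner (u (i x)) hu0)).congr_of_eventuallyEq ?_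
    filter_upwards [hOev] with y hy
    exact hMeq x hxO hxI y hy
  have hui : ∀ ξ η, HasDirDeriv (fun x => (inner ℂ (u (i x)) (A η)).im) x₀ ξ
      (-(inner ℂ (A ξ) (A η)).im) := by
    intro ξ η
    have h1 : HasDirDeriv (fun x => u (i x)) x₀ ξ (A (-ξ)) := by
      have := HasContDirDerivNear.hasDirDeriv_comp (γ := i) (y := x₀) (f := u) (f' := u')
        (by rwa [hix₀]) (hid ξ)
      rwa [hix₀] at this
    -- The variable sits in the antilinear slot; swapping the slots at the cost of a sign yields a
    -- real linear functional.
    have h2 := h1.clm_comp (-(Complex.imCLM.comp ((innerSL ℂ (A η)).restrictScalars ℝ)))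
    have h3 : ∀ w : H, (-(Complex.imCLM.comp ((innerSL ℂ (A η)).restrictScalars ℝ))) w =
        (inner ℂ w (A η)).im := by
      intro w
      rw [← inner_conj_symm, Complex.conj_im]
      rfl
    simp only [h3] at h2
    rwa [map_neg, inner_neg_left, Complex.neg_im] at h2
  have hMd2 : ∀ ξ η, dirDeriv (fun p => dirDeriv (M p) (x₀, 0) (η, 0)) (x₀, 0) (ξ, 0) =
      (m'' (x₀, x₀) (0, η) (ξ, 0), -(inner ℂ (A ξ) (A η)).im) := fun ξ η =>
    (hasDirDeriv_mk_zero_iff (f := fun p => dirDeriv (M p) (x₀, 0) (η, 0)).2 (((hmd2 ξ η).prodMk (hui ξ η)).congr_of_eventuallyEq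
      (hMd η))).dirDeriv_eq
  have hmG : ∀ ξ η, dirDeriv (fun x => dirDeriv (fun y => m (x, y)) x₀ η) x₀ ξ =
      m'' (x₀, x₀) (0, η) (ξ, 0) := fun ξ η =>
    ((hmd2 ξ η).congr_of_eventuallyEq
      (hWev.mono fun x hx => (hmd x hx η).dirDeriv_eq)).dirDeriv_eq
  refine ⟨A, fun ξ η => ?_⟩
  -- The same second derivatives form the first component of the bracket of `𝔤♯`.
  have hbr : ⁅ξ, η⁆ = m'' (x₀, x₀) (0, η) (ξ, 0) - m'' (x₀, x₀) (0, ξ) (η, 0) := by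
    rw [hG ξ η, ← hmG ξ η, ← hmG η ξ]
    rfl
  have h1 : (sharpChart ρ φ 1 : 𝔤 × ℝ) = (x₀, 0) := by
    refine Prod.ext rfl ?_
    change (inner ℂ φ φ).arg = 0
    rw [hφφ, Complex.arg_one]
  have h2 : (inner ℂ (A η) (A ξ)).im = -(inner ℂ (A ξ) (A η)).im := by
    rw [← inner_conj_symm, Complex.conj_im]
  rw [sharpBracket, h1, chartBracket]
  change dirDeriv (fun p => dirDeriv (M p) (x₀, 0) (η, 0)) (x₀, 0) (ξ, 0) -
    dirDeriv (fun p => dirDeriv (M p) (x₀, 0) (ξ, 0)) (x₀, 0) (η, 0) = _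
  rw [hMd2, hMd2, Prod.mk_sub_mk, ← hbr, h2]
  congr 1
  ring

end Bracket

end

/-! ### The representative cocycle and its positive form -/

theorem proposition6p5
    {𝔤 : Type*} [LieRing 𝔤] [LieAlgebra ℝ 𝔤] [TopologicalSpace 𝔤] [IsLocallyConvexLieAlgebra 𝔤]
    {G : Type*} [Group G] [TopologicalSpace G] [ChartedSpace 𝔤 G] [IsLocallyConvexLieGroup 𝔤 G]
    (hG : IsLieAlgebraOf 𝔤 G)
    {H : Type*} [NormedAddCommGroup H] [InnerProductSpace ℂ H] [CompleteSpace H]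
    (ρ : G →* ProjUnitary H) (hρ : IsSmoothProjRep 𝔤 ρ)
    (c : ContH2 𝔤) (hc : CorrespondsTo ρ c) :
    ∃ (ω : ContTwoCocycles 𝔤) (h : Complexified 𝔤 →ₗ⋆[ℂ] Complexified 𝔤 →ₗ[ℂ] ℂ),
      cohomClass ω = c ∧
      IsContPosSemidef h ∧
      (∀ ξ η : 𝔤, ω.1 ξ η =
        -2 * (h (Complexified.ofReal ξ) (Complexified.ofReal η)).im) ∧
      sesqKer h ⊆ Complexified.complexify (formKer ω.1) ∧
      ∀ ξ η : 𝔤, (1 / 2 : ℝ) * |ω.1 ξ η| ≤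
        √(h (Complexified.ofReal ξ) (Complexified.ofReal ξ)).re *
          √(h (Complexified.ofReal η) (Complexified.ofReal η)).re := by
  obtain ⟨ψ, hψ, hsm, ω, rfl, σ, hσ, hω⟩ := hc
  have hn : 0 < ‖ψ‖ := norm_pos_iff.2 hψ
  have hnc : ((‖ψ‖ : ℝ) : ℂ) ≠ 0 := by exact_mod_cast hn.ne'
  obtain ⟨φ, hφ⟩ : ∃ φ : H, ψ = (‖ψ‖ : ℂ) • φ :=
    ⟨(‖ψ‖ : ℂ)⁻¹ • ψ, by rw [smul_smul, mul_inv_cancel₀ hnc, one_smul]⟩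
  have hφ1 : ‖φ‖ = 1 := by
    have h := congrArg norm hφ
    rw [norm_smul, Complex.norm_real, norm_norm] at h
    exact mul_left_cancel₀ hn.ne' (by rw [← h, mul_one])
  have hφ0 : φ ≠ 0 := norm_ne_zero_iff.1 (by rw [hφ1]; exact one_ne_zero)
  have hray : Projectivization.mk ℂ ψ hψ = Projectivization.mk ℂ φ hφ0 :=
    (Projectivization.mk_eq_mk_iff' ℂ _ _ _ _).2 ⟨_, hφ.symm⟩
  have hbr : (sharpBracket ρ ψ : 𝔤 × ℝ → 𝔤 × ℝ → 𝔤 × ℝ) = sharpBracket ρ φ := by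
    conv_lhs => rw [hφ]
    exact sharpBracket_smul ρ φ hn
  rw [hray] at hsm
  obtain ⟨A, hA⟩ := exists_sharpBracket_eq hG ρ hφ1 hφ0 hsm
  -- `β` measures how `σ` differs from the projection `𝔤 × ℝ → ℝ`; adding its coboundary cancels the
  -- term `β ⁅ξ, η⁆` in `ω` and leaves the central component of the bracket.
  set β : 𝔤 →L[ℝ] ℝ := σ.comp (ContinuousLinearMap.inl ℝ 𝔤 ℝ) with hβ
  have key : ∀ ξ η : 𝔤, (ω + coboundary β).1 ξ η = -2 * (inner ℂ (A ξ) (A η)).im := by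
    intro ξ η
    have h1 : ω.1 ξ η = β ⁅ξ, η⁆ + -2 * (inner ℂ (A ξ) (A η)).im := by
      have h2 : σ (⁅ξ, η⁆, 0) + σ (0, -2 * (inner ℂ (A ξ) (A η)).im) =
          σ (⁅ξ, η⁆, -2 * (inner ℂ (A ξ) (A η)).im) := by
        rw [← map_add, Prod.mk_add_mk, add_zero, zero_add]
      rw [hω (ξ, 0) (η, 0), hbr, hA, ← h2, hσ]
      rfl
    change ω.1 ξ η + -β ⁅ξ, η⁆ = _
    rw [h1]
    ring
  refine ⟨ω + coboundary β, orbitForm A, cohomClass_add_coboundary ω β,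
    isContPosSemidef_orbitForm A, fun ξ η => by rw [key, im_orbitForm_ofReal], ?_,
    fun ξ η => by rw [key]; exact half_abs_neg_two_mul_im_inner_le A ξ η⟩
  intro ζ hζ
  obtain ⟨h1, h2⟩ := eq_zero_of_mem_sesqKer_orbitForm A hζ
  exact ⟨fun η => by rw [key, h1, inner_zero_left, Complex.zero_im, mul_zero],
    fun η => by rw [key, h2, inner_zero_left, Complex.zero_im, mul_zero]⟩
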